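/- For a function $p:\mathbb{N}\to[0,1]$, let $\mathcal{G}(n,p)$ denote the Erdős–Rényi random graph on $n$ vertices in which each of the $\binom n2$ possible edges is present independently with probability $p=p(n)$. Let $L=D-A$ be the Laplacian matrix of a realization of this graph, where $D$ is its diagonal degree matrix and $A$ its adjacency matrix, and let $0=\lambda_1(L)\le\lambda_2(L)\le\cdots\le\lambda_n(L)$ be the eigenvalues of $L$, counted with multiplicity. Suppose that $$\limsup_{n\to\infty}\frac{\ln n}{n\,p(n)}<1,$$ where for $n\ge 2$ the quotient is $+\infty$ if $p(n)=0$. Then there is a constant $\gamma>0$, which may depend on the function $p$ but not on $n$, such that the algebraic connectivity satisfies $\lambda_2(L)\ge\gamma\,n\,p(n)$ asymptotically almost surely, that is, $$\lim_{n\to\infty}\Pr\bigl[\lambda_2(L)\ge\gamma\,n\,p(n)\bigr]=1.$$ -/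

import Mathlib

open Filter Topology MeasureTheory

open Classical in
/-- The algebraic connectivity `λ₂(L)` of a finite simple graph `G`: the second smallest eigenvalue,
counted with multiplicity, of its Laplacian matrix `L = D - A`. Mathlib lists the eigenvalues of a
Hermitian matrix in decreasing order with indices `0, …, |V| - 1`, so the second smallest one has
index `|V| - 2`. On fewer than two vertices there is no second eigenvalue and the value is `0`. -/
noncomputable def algebraicConnectivity {V : Type*} [Fintype V] (G : SimpleGraph V) : ℝ :=
  if h : 2 ≤ Fintype.card V then
    (G.isHermitian_lapMatrix ℝ).eigenvalues₀ ⟨Fintype.card V - 2, by omega⟩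
  else 0

/-- For a sequence of edge probabilities `p`, the random graph `G(n, p n)` on the vertex set `Fin n`
has the property `P` asymptotically almost surely: the probability of the set of graphs with that
property tends to `1` as `n → ∞`. -/
def AsymptoticallyAlmostSurely (p : ℕ → unitInterval)
    (P : ∀ n : ℕ, SimpleGraph (Fin n) → Prop) : Prop :=
  Tendsto (fun n : ℕ => SimpleGraph.binomialRandom (Fin n) (p n) {G | P n G}) atTop (𝓝 1)

/-! Cheeger's inequality (`cheeger_le_algebraicConnectivity`) reduces the claim to two typical
properties of the graph: all degrees are at most `4np`, and every `S` with `|S| ≤ n/2` has at least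
`ε np |S|` outgoing edges. Together they give `λ₂ ≥ (ε²/8) np`.

Both properties follow from exponential Markov bounds and a union bound. Fix `c < 1` with `ln n ≤ c
np` eventually. A small set of size `k` fails with probability at most `q ^ k`, `q = n ^
(-(1-3a)/c)`. Summed over nonempty sets this is at most `(1+q)^n - 1`, which vanishes because `nq →
0` when `c < 1 - 3a`; this is where the limsup being below `1` is needed. For larger sets the bound
`exp(-const · n ln n)` beats the `2^n` choices. -/

namespace SimpleGraph

/-! ### Cheeger's inequality for quadratic forms -/

section Cheeger

variable {V : Type*} [Fintype V] [DecidableEq V] (G : SimpleGraph V) [DecidableRel G.Adj]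

/-- Each cut edge is counted once per orientation, whence the factor `2`. This is the layer removed
at each step of the co-area induction. -/
theorem sum_adj_abs_indicator_sub (S : Finset V) :
    ∑ i, ∑ j, (if G.Adj i j then |(if i ∈ S then (1 : ℝ) else 0) - (if j ∈ S then 1 else 0)| else 0)
      = 2 * ((G.interedges S Sᶜ).card : ℝ) := by
  have hcard : ((G.interedges S Sᶜ).card : ℝ)
      = ∑ i, ∑ j, if G.Adj i j then (if i ∈ S ∧ j ∉ S then (1 : ℝ) else 0) else 0 := by
    have : G.interedges S Sᶜ
        = Finset.univ.filter (fun x : V × V => G.Adj x.1 x.2 ∧ x.1 ∈ S ∧ x.2 ∉ S) := by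
      ext
      simp only [mem_interedges_iff, Finset.mem_compl, Finset.mem_filter, Finset.mem_univ]
      tauto
    rw [this, ← Finset.sum_product', Finset.univ_product_univ, Finset.natCast_card_filter]
    simp_rw [ite_and]
  have hcard' : ((G.interedges S Sᶜ).card : ℝ)
      = ∑ i, ∑ j, if G.Adj i j then (if j ∈ S ∧ i ∉ S then (1 : ℝ) else 0) else 0 := by
    rw [hcard, Finset.sum_comm]
    simp_rw [G.adj_comm]
  rw [two_mul]
  nth_rw 1 [hcard]
  rw [hcard']
  simp_rw [← Finset.sum_add_distrib]
  refine Finset.sum_congr rfl fun i _ => Finset.sum_congr rfl fun j _ => ?_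
  by_cases hi : i ∈ S <;> by_cases hj : j ∈ S <;> simp [hi, hj]

/-- The discrete co-area inequality. -/
theorem two_mul_sum_le_sum_adj_abs_sub {h : ℝ}
    (hG : ∀ S : Finset V, 2 * S.card ≤ Fintype.card V →
      h * S.card ≤ ((G.interedges S Sᶜ).card : ℝ))
    (φ : V → ℝ) (hφ : ∀ i, 0 ≤ φ i)
    (hcard : 2 * (Finset.univ.filter fun i => φ i ≠ 0).card ≤ Fintype.card V) :
    2 * h * ∑ i, φ i ≤ ∑ i, ∑ j, if G.Adj i j then |φ i - φ j| else 0 := by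
  induction hn : (Finset.univ.filter fun i => φ i ≠ 0).card using Nat.strong_induction_on
    generalizing φ with
  | _ n ih =>
  set S := Finset.univ.filter fun i => φ i ≠ 0 with hS
  have memS : ∀ i, i ∈ S ↔ φ i ≠ 0 := fun i => by simp [hS]
  rcases S.eq_empty_or_nonempty with hSe | hSn
  · have h0 : ∀ i, φ i = 0 := fun i => by
      by_contra hne
      have := (memS i).2 hne
      simp [hSe] at this
    simp [h0]
  · obtain ⟨k, hk, hmin⟩ := S.exists_min_image φ hSn
    set m := φ k
    have hm : 0 < m := lt_of_le_of_ne (hφ k) ((memS k).1 hk).symm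
    -- Peeling off the lowest layer of height `m` kills the minimizer `k`, so the support shrinks,
    -- while the total variation splits exactly.
    set ψ : V → ℝ := fun i => φ i - m * (if i ∈ S then 1 else 0) with hψ
    have hψ0 : ∀ i, 0 ≤ ψ i := fun i => by
      by_cases hi : i ∈ S
      · simpa [hψ, hi] using hmin i hi
      · simpa [hψ, hi] using hφ i
    have hout : ∀ i, i ∉ S → φ i = 0 := fun i hi => by
      by_contra hne
      exact hi ((memS i).2 hne)
    have hsub : (Finset.univ.filter fun i => ψ i ≠ 0) ⊂ S := by
      refine Finset.ssubset_iff_of_subset ?_ |>.2 ⟨k, hk, by simp [hψ, hk, m]⟩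
      intro i hi
      by_contra hiS
      simp [hψ, hiS, hout i hiS] at hi
    have hlt := Finset.card_lt_card hsub
    have key := ih _ (hn ▸ hlt) ψ hψ0 (by omega) rfl
    have hsum : ∑ i, φ i = ∑ i, ψ i + m * S.card := by
      simp [hψ, Finset.sum_sub_distrib, mul_comm]
    have hsplit : ∑ i, ∑ j, (if G.Adj i j then |φ i - φ j| else 0)
        = ∑ i, ∑ j, (if G.Adj i j then |ψ i - ψ j| else 0)
          + m * (2 * ((G.interedges S Sᶜ).card : ℝ)) := by
      rw [← sum_adj_abs_indicator_sub, Finset.mul_sum, ← Finset.sum_add_distrib]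
      refine Finset.sum_congr rfl fun i _ => ?_
      rw [Finset.mul_sum, ← Finset.sum_add_distrib]
      refine Finset.sum_congr rfl fun j _ => ?_
      split_ifs with hij hi hj hj
      · simp [hψ, hi, hj]
      · have h1 := hψ0 i
        simp only [hψ, hi, hj, if_true, if_false, hout j hj] at h1 ⊢
        rw [abs_of_nonneg (by linarith), abs_of_nonneg (by linarith)]
        simp
      · have h1 := hψ0 j
        simp only [hψ, hi, hj, if_true, if_false, hout i hi] at h1 ⊢
        rw [abs_of_nonpos (by linarith), abs_of_nonpos (by linarith)]
        simp
      · simp [hψ, hi, hj]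
      · simp
    have := hG S hcard
    rw [hsum, hsplit]
    nlinarith

omit [DecidableEq V] in
theorem sum_adj_left_le {D : ℝ} (hD : ∀ i, (G.degree i : ℝ) ≤ D) (w : V → ℝ) (hw : ∀ i, 0 ≤ w i) :
    ∑ i, ∑ j, (if G.Adj i j then w i else 0) ≤ D * ∑ i, w i := by
  rw [Finset.mul_sum]
  refine Finset.sum_le_sum fun i _ => ?_
  have : ∑ j, (if G.Adj i j then w i else 0) = G.degree i * w i := by
    rw [degree_eq_sum_if_adj, Finset.sum_mul]
    simp
  rw [this]
  exact mul_le_mul_of_nonneg_right (hD i) (hw i)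

/-- The Cheeger inequality for functions supported on at most half of the vertices. -/
theorem cheeger_of_card_support_le {h D : ℝ} (hh : 0 ≤ h)
    (hG : ∀ S : Finset V, 2 * S.card ≤ Fintype.card V →
      h * S.card ≤ ((G.interedges S Sᶜ).card : ℝ))
    (hD : ∀ i, (G.degree i : ℝ) ≤ D)
    (g : V → ℝ)
    (hcard : 2 * (Finset.univ.filter fun i => g i ≠ 0).card ≤ Fintype.card V) :
    h ^ 2 * ∑ i, g i ^ 2 ≤ D * ∑ i, ∑ j, if G.Adj i j then (g i - g j) ^ 2 else 0 := by
  set X := ∑ i, g i ^ 2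
  set Y := ∑ i, ∑ j, if G.Adj i j then (g i - g j) ^ 2 else 0
  have hX : 0 ≤ X := Finset.sum_nonneg fun i _ => sq_nonneg _
  have hY : 0 ≤ Y := Finset.sum_nonneg fun i _ => Finset.sum_nonneg fun j _ => by
    split_ifs <;> positivity
  have h1 : 2 * h * X ≤ ∑ i, ∑ j, if G.Adj i j then |g i ^ 2 - g j ^ 2| else 0 :=
    G.two_mul_sum_le_sum_adj_abs_sub hG (fun i => g i ^ 2) (fun i => sq_nonneg _) (by simpa using hcard)
  -- Cauchy–Schwarz on `g i ^ 2 - g j ^ 2 = (g i - g j) * (g i + g j)`.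
  have h2 : (∑ i, ∑ j, if G.Adj i j then |g i ^ 2 - g j ^ 2| else 0) ^ 2
      ≤ Y * ∑ i, ∑ j, if G.Adj i j then (g i + g j) ^ 2 else 0 := by
    have := Finset.sum_mul_sq_le_sq_mul_sq (Finset.univ : Finset (V × V))
      (fun x => if G.Adj x.1 x.2 then |g x.1 - g x.2| else 0)
      (fun x => if G.Adj x.1 x.2 then |g x.1 + g x.2| else 0)
    simp only [ite_pow, sq_abs, ite_mul_ite, ← abs_mul, mul_zero, ne_eq,
      OfNat.ofNat_ne_zero, not_false_eq_true, zero_pow] at this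
    rw [Fintype.sum_prod_type, Fintype.sum_prod_type, Fintype.sum_prod_type] at this
    have hab : ∀ a b : ℝ, |a ^ 2 - b ^ 2| = |(a - b) * (a + b)| := fun a b => by ring_nf
    simp_rw [hab]
    exact this
  have h3 : (∑ i, ∑ j, if G.Adj i j then (g i + g j) ^ 2 else 0) ≤ 4 * (D * X) := by
    have ha := G.sum_adj_left_le hD (fun i => g i ^ 2) (fun i => sq_nonneg _)
    have hb : ∑ i, ∑ j, (if G.Adj i j then g j ^ 2 else 0)
        = ∑ i, ∑ j, (if G.Adj i j then g i ^ 2 else 0) := by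
      rw [Finset.sum_comm]
      simp_rw [G.adj_comm]
    calc _ ≤ ∑ i, ∑ j, (2 * (if G.Adj i j then g i ^ 2 else 0)
            + 2 * (if G.Adj i j then g j ^ 2 else 0)) := by
          refine Finset.sum_le_sum fun i _ => Finset.sum_le_sum fun j _ => ?_
          split_ifs
          · nlinarith [sq_nonneg (g i - g j)]
          · simp
      _ ≤ _ := by
          simp_rw [Finset.sum_add_distrib, ← Finset.mul_sum]
          rw [hb]
          linarith
  have h4 : (2 * h * X) ^ 2 ≤ Y * (4 * (D * X)) :=
    (pow_le_pow_left₀ (by positivity) h1 2).trans (h2.trans (mul_le_mul_of_nonneg_left h3 hY))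
  rcases hX.eq_or_lt with h0 | hpos
  · rw [← h0, mul_zero]
    rcases isEmpty_or_nonempty V with he | ⟨⟨i⟩⟩
    · simp [Y]
    · exact mul_nonneg ((Nat.cast_nonneg _).trans (hD i)) hY
  · refine le_of_mul_le_mul_right ?_ hpos
    nlinarith

/-- A median of a real function on a finite type. -/
theorem exists_median [Nonempty V] (f : V → ℝ) :
    ∃ m, 2 * (Finset.univ.filter fun i => m < f i).card ≤ Fintype.card V ∧
      2 * (Finset.univ.filter fun i => f i < m).card ≤ Fintype.card V := by
  set T := (Finset.univ : Finset V).filter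
    fun k => 2 * (Finset.univ.filter fun i => f k < f i).card ≤ Fintype.card V with hT
  have hTn : T.Nonempty := by
    obtain ⟨k, -, hk⟩ := Finset.univ.exists_max_image f (Finset.univ_nonempty (α := V))
    refine ⟨k, ?_⟩
    have : (Finset.univ.filter fun i => f k < f i) = ∅ := by
      ext i
      simpa using hk i (Finset.mem_univ i)
    simp [hT, this]
  -- The median is the least value with at most half of the vertices above it. The next lower value
  -- `f l` has more than half above it, and these are disjoint from the vertices below `f k`.
  obtain ⟨k, hk, hmin⟩ := T.exists_min_image f hTn
  refine ⟨f k, (Finset.mem_filter.1 hk).2, ?_⟩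
  rcases (Finset.univ.filter fun i => f i < f k).eq_empty_or_nonempty with he | hne
  · simp [he]
  obtain ⟨l, hl, hmax⟩ := Finset.exists_max_image _ f hne
  have hl' : f l < f k := by simpa using hl
  have hlT : ¬ 2 * (Finset.univ.filter fun i => f l < f i).card ≤ Fintype.card V := fun hle =>
    absurd (hmin l (by simp [hT, hle])) (not_le.2 hl')
  have hdisj : Disjoint (Finset.univ.filter fun i => f i < f k)
      (Finset.univ.filter fun i => f l < f i) := by
    rw [Finset.disjoint_left]
    intro i hi hi'
    exact absurd (hmax i hi) (not_le.2 (by simpa using hi'))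
  have := Finset.card_le_univ ((Finset.univ.filter fun i => f i < f k) ∪
      (Finset.univ.filter fun i => f l < f i))
  rw [Finset.card_union_of_disjoint hdisj] at this
  omega

/-- The Cheeger inequality in variational form. -/
theorem cheeger_of_sum_eq_zero {h D : ℝ} (hh : 0 ≤ h)
    (hG : ∀ S : Finset V, 2 * S.card ≤ Fintype.card V →
      h * S.card ≤ ((G.interedges S Sᶜ).card : ℝ))
    (hD : ∀ i, (G.degree i : ℝ) ≤ D) (f : V → ℝ) (hf : ∑ i, f i = 0) :
    h ^ 2 * ∑ i, f i ^ 2 ≤ D * ∑ i, ∑ j, if G.Adj i j then (f i - f j) ^ 2 else 0 := by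
  rcases isEmpty_or_nonempty V with he | hne
  · simp
  have hD0 : 0 ≤ D := (Nat.cast_nonneg _).trans (hD hne.some)
  obtain ⟨m, hm1, hm2⟩ := exists_median f
  have hp := G.cheeger_of_card_support_le hh hG hD (fun i => max (f i - m) 0)
    (by simpa using hm1)
  have hq := G.cheeger_of_card_support_le hh hG hD (fun i => max (m - f i) 0)
    (by simpa using hm2)
  -- Since `f` has zero sum, shifting by the median only increases the sum of squares.
  have hsum : ∑ i, f i ^ 2 ≤ ∑ i, max (f i - m) 0 ^ 2 + ∑ i, max (m - f i) 0 ^ 2 := by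
    have : ∀ i, max (f i - m) 0 ^ 2 + max (m - f i) 0 ^ 2 = f i ^ 2 - 2 * m * f i + m ^ 2 := by
      intro i
      rcases le_total (f i) m with hle | hle
      · rw [max_eq_right (by linarith), max_eq_left (by linarith)]; ring
      · rw [max_eq_left (by linarith), max_eq_right (by linarith)]; ring
    rw [← Finset.sum_add_distrib]
    simp_rw [this, Finset.sum_add_distrib, Finset.sum_sub_distrib, ← Finset.mul_sum, hf]
    simp
    positivity
  have hdiff : ∑ i, ∑ j, (if G.Adj i j then (max (f i - m) 0 - max (f j - m) 0) ^ 2 else 0)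
      + ∑ i, ∑ j, (if G.Adj i j then (max (m - f i) 0 - max (m - f j) 0) ^ 2 else 0)
      ≤ ∑ i, ∑ j, if G.Adj i j then (f i - f j) ^ 2 else 0 := by
    simp_rw [← Finset.sum_add_distrib]
    refine Finset.sum_le_sum fun i _ => Finset.sum_le_sum fun j _ => ?_
    split_ifs
    · rcases le_total (f i) m with hi | hi <;> rcases le_total (f j) m with hj | hj <;>
        simp only [sub_nonneg, sub_nonpos, hi, hj, max_eq_left, max_eq_right] <;> nlinarith
    · simp
  calc _ ≤ h ^ 2 * (∑ i, max (f i - m) 0 ^ 2 + ∑ i, max (m - f i) 0 ^ 2) := by gcongr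
    _ ≤ D * (∑ i, ∑ j, (if G.Adj i j then (max (f i - m) 0 - max (f j - m) 0) ^ 2 else 0)
      + ∑ i, ∑ j, (if G.Adj i j then (max (m - f i) 0 - max (m - f j) 0) ^ 2 else 0)) := by
        rw [mul_add, mul_add]
        exact add_le_add hp hq
    _ ≤ _ := by gcongr

end Cheeger

end SimpleGraph

/-! ### From quadratic forms to the second eigenvalue -/

/-- A quadratic form bound on the vectors with zero sum bounds the second smallest eigenvalue. -/
theorem Matrix.IsHermitian.le_eigenvalues₀_card_sub_two {V : Type*} [Fintype V] [DecidableEq V]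
    {A : Matrix V V ℝ} (hA : A.IsHermitian) (hV : 2 ≤ Fintype.card V) {μ : ℝ}
    (h : ∀ x : V → ℝ, ∑ i, x i = 0 → μ * ∑ i, x i ^ 2 ≤ x ⬝ᵥ A.mulVec x) :
    μ ≤ hA.eigenvalues₀ ⟨Fintype.card V - 2, by omega⟩ := by
  set T := Matrix.toEuclideanLin A
  have hT : T.IsSymmetric := Matrix.isSymmetric_toEuclideanLin_iff.mpr hA
  set k : Fin (Fintype.card V) := ⟨Fintype.card V - 2, by omega⟩
  set l : Fin (Fintype.card V) := ⟨Fintype.card V - 1, by omega⟩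
  have hkl : k ≠ l := by simp [k, l]; omega
  have hle : hA.eigenvalues₀ l ≤ hA.eigenvalues₀ k :=
    hA.eigenvalues₀_antitone (by simp [k, l]; omega)
  set b := hT.eigenvectorBasis finrank_euclideanSpace
  -- The span of the last two eigenvectors is a plane, so it meets the zero-sum hyperplane in a
  -- nonzero vector; its Rayleigh quotient is at most the larger eigenvalue, that of index `k`.
  obtain ⟨s, t, hst, h0⟩ : ∃ s t : ℝ, 0 < s ^ 2 + t ^ 2 ∧
      s * ∑ i, b k i + t * ∑ i, b l i = 0 := by
    by_cases hz : ∑ i, b l i = 0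
    · exact ⟨0, 1, by norm_num, by simp [hz]⟩
    · exact ⟨∑ i, b l i, -∑ i, b k i, by positivity, by ring⟩
  set z := s • b k + t • b l
  have hTk : T (b k) = hA.eigenvalues₀ k • b k := hT.apply_eigenvectorBasis finrank_euclideanSpace k
  have hTl : T (b l) = hA.eigenvalues₀ l • b l := hT.apply_eigenvectorBasis finrank_euclideanSpace l
  have hz : ∑ i, z i = 0 := by
    simp [z, Finset.sum_add_distrib, ← Finset.mul_sum, h0]
  have kk : inner ℝ (b k) (b k) = 1 := by simp [b.orthonormal.1]
  have ll : inner ℝ (b l) (b l) = 1 := by simp [b.orthonormal.1]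
  have kl : inner ℝ (b k) (b l) = 0 := b.orthonormal.2 hkl
  have lk : inner ℝ (b l) (b k) = 0 := b.orthonormal.2 hkl.symm
  have hn : ∑ i, z i ^ 2 = s ^ 2 + t ^ 2 := by
    have h1 : inner ℝ z z = s ^ 2 + t ^ 2 := by
      simp only [z, inner_add_left, inner_add_right, inner_smul_left, inner_smul_right, kk, ll, kl,
        lk]
      simp; ring
    rw [← h1, PiLp.inner_apply]
    simp [sq]
  have hq : z.ofLp ⬝ᵥ A.mulVec z.ofLp = hA.eigenvalues₀ k * s ^ 2 + hA.eigenvalues₀ l * t ^ 2 := by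
    have h1 : inner ℝ z (T z) = hA.eigenvalues₀ k * s ^ 2 + hA.eigenvalues₀ l * t ^ 2 := by
      simp only [z, map_add, map_smul, hTk, hTl, inner_add_left, inner_add_right, inner_smul_left,
        inner_smul_right, kk, ll, kl, lk]
      simp; ring
    rw [← h1, PiLp.inner_apply]
    simp [dotProduct, T, mul_comm]
  have := h z.ofLp hz
  rw [hn, hq] at this
  have h2 : hA.eigenvalues₀ l * t ^ 2 ≤ hA.eigenvalues₀ k * t ^ 2 := by gcongr
  nlinarith

/-- The Cheeger inequality `λ₂(L) ≥ h ^ 2 / (2 D)`, for the edge expansion `h` and the maximal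
degree `D`. -/
theorem cheeger_le_algebraicConnectivity {V : Type*} [Fintype V] [DecidableEq V]
    (G : SimpleGraph V) [DecidableRel G.Adj] (hV : 2 ≤ Fintype.card V) {h D : ℝ} (hh : 0 ≤ h)
    (hD0 : 0 < D)
    (hG : ∀ S : Finset V, 2 * S.card ≤ Fintype.card V →
      h * S.card ≤ ((G.interedges S Sᶜ).card : ℝ))
    (hD : ∀ i, (G.degree i : ℝ) ≤ D) :
    h ^ 2 / (2 * D) ≤ algebraicConnectivity G := by
  rw [algebraicConnectivity, dif_pos hV]
  -- The definition uses classical decidability instances; `convert` reconciles them with the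
  -- ambient ones.
  suffices h ^ 2 / (2 * D) ≤ (G.isHermitian_lapMatrix ℝ).eigenvalues₀
      ⟨Fintype.card V - 2, by omega⟩ by convert this
  refine (G.isHermitian_lapMatrix ℝ).le_eigenvalues₀_card_sub_two hV fun x hx => ?_
  have key := G.cheeger_of_sum_eq_zero hh hG hD x hx
  rw [← Matrix.toLinearMap₂'_apply', SimpleGraph.lapMatrix_toLinearMap₂', div_mul_eq_mul_div,
    div_le_div_iff₀ (by positivity) two_pos]
  convert mul_le_mul_of_nonneg_right key two_pos.le using 1
  rw [mul_comm 2 D, ← mul_assoc, mul_comm _ D]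

/-! ### Exponential moments of cut sizes -/

namespace SimpleGraph

/-- Makes every event a finite sum of singleton probabilities. -/
instance {V : Type*} [Finite V] : MeasurableSingletonClass (SimpleGraph V) where
  measurableSet_singleton G := by
    have := measurable_edgeSet (V := V) (measurableSet_singleton G.edgeSet)
    convert this
    ext H
    simp

section RandomGraph

variable {V : Type*} [Fintype V]

open Classical in
/-- The probability generating function of the number of edges inside a set of pairs. -/
theorem sum_binomialRandom_mul_pow (p : unitInterval) (F : Finset (Sym2 V))
    (hF : ∀ e ∈ F, ¬ e.IsDiag) (x : ℝ) :
    ∑ G : SimpleGraph V, (binomialRandom V p).real {G} * x ^ (F.filter (· ∈ G.edgeSet)).card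
      = (1 - p + p * x) ^ F.card := by
  set U : Finset (Sym2 V) := Finset.univ.filter fun e => ¬ e.IsDiag with hU
  have hFU : F ⊆ U := fun e he => by simpa [hU] using hF e he
  have hcard : (Nat.card V).choose 2 = U.card := by
    rw [Nat.card_eq_fintype_card, ← Sym2.card_diagSet_compl, Fintype.card_subtype]
    congr 1
  -- Pairs outside `F` contribute the factor `p + (1 - p) = 1`, so expanding the product over all of
  -- `U` gives one term per graph.
  have hR : ((1 : ℝ) - p + p * x) ^ F.card
      = ∏ e ∈ U, ((p : ℝ) * (if e ∈ F then x else 1) + (1 - p)) := by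
    rw [← Finset.prod_subset hFU, Finset.prod_congr rfl (g := fun _ => (1 : ℝ) - p + p * x),
      Finset.prod_const]
    · intro e he
      simp [he]; ring
    · intro e _ he
      simp [he]
  rw [hR, Finset.prod_add]
  symm
  refine Finset.sum_bij' (fun T _ => fromEdgeSet (T : Set (Sym2 V))) (fun G _ => G.edgeFinset)
    (fun _ _ => Finset.mem_univ _) ?_ ?_ ?_ ?_
  · intro G _
    rw [Finset.mem_powerset]
    intro e he
    simpa [hU] using G.not_isDiag_of_mem_edgeFinset he
  · intro T hT
    rw [Finset.mem_powerset] at hT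
    ext e
    simp only [mem_edgeFinset, edgeSet_fromEdgeSet]
    constructor
    · exact fun h => h.1
    · intro h
      exact ⟨h, by simpa [hU] using hT h⟩
  · intro G _
    simp
  · intro T hT
    rw [Finset.mem_powerset] at hT
    have hes : (fromEdgeSet (T : Set (Sym2 V))).edgeSet = T := by
      ext e
      simp only [edgeSet_fromEdgeSet]
      constructor
      · exact fun h => h.1
      · intro h
        exact ⟨h, by simpa [hU] using hT h⟩
    have hm : (binomialRandom V p).real {fromEdgeSet (T : Set (Sym2 V))}
        = (p : ℝ) ^ T.card * (1 - p) ^ (U.card - T.card) := by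
      rw [measureReal_def, binomialRandom_singleton, hes, Set.ncard_coe_finset, hcard]
      simp
    simp only [hm, hes, Finset.mem_coe, Finset.filter_mem_eq_inter]
    rw [Finset.prod_mul_distrib, Finset.prod_const, Finset.prod_const,
      Finset.card_sdiff_of_subset hT, Finset.prod_ite, Finset.filter_mem_eq_inter,
      Finset.inter_comm F T]
    simp
    ring

open Classical in
theorem sum_binomialRandom_mul_pow_interedges (p : unitInterval) (S : Finset V) (x : ℝ) :
    ∑ G : SimpleGraph V, (binomialRandom V p).real {G} * x ^ (G.interedges S Sᶜ).card
      = (1 - p + p * x) ^ (S.card * (Fintype.card V - S.card)) := by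
  have hinj : Set.InjOn (fun x : V × V => s(x.1, x.2)) (S ×ˢ Sᶜ : Finset (V × V)) := by
    rintro ⟨a, b⟩ h ⟨c, d⟩ h' he
    simp only [Finset.coe_product, Set.mem_prod, Finset.mem_coe, Finset.mem_compl] at h h'
    simp only [Sym2.eq_iff] at he
    rcases he with ⟨rfl, rfl⟩ | ⟨rfl, rfl⟩
    · rfl
    · exact absurd h.1 h'.2
  have := sum_binomialRandom_mul_pow p ((S ×ˢ Sᶜ).image fun x : V × V => s(x.1, x.2)) (by
    intro e he
    simp only [Finset.mem_image, Finset.mem_product, Finset.mem_compl, Prod.exists] at he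
    obtain ⟨a, b, ⟨ha, hb⟩, rfl⟩ := he
    rw [Sym2.mk_isDiag_iff]
    rintro rfl
    exact hb ha) x
  rw [Finset.card_image_of_injOn hinj, Finset.card_product, Finset.card_compl] at this
  rw [← this]
  refine Finset.sum_congr rfl fun G _ => ?_
  rw [Finset.filter_image, Finset.card_image_of_injOn (hinj.mono fun e he => Finset.filter_subset _ _ he)]
  congr 2

/-- The exponential Markov inequality for the number of edges leaving a set of vertices. -/
theorem binomialRandom_real_le_of_interedges (p : unitInterval) (S : Finset V) {s b : ℝ}
    {B : Set (SimpleGraph V)}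
    (hB : ∀ G ∈ B, open Classical in b ≤ s * (G.interedges S Sᶜ).card) :
    (binomialRandom V p).real B
      ≤ Real.exp (p * (Real.exp s - 1) * (S.card * (Fintype.card V - S.card)) - b) := by
  classical
  have h1 : (binomialRandom V p).real B
      = ∑ G ∈ B.toFinset, (binomialRandom V p).real {G} := by
    rw [sum_measureReal_singleton, Set.coe_toFinset]
  have h2 : (binomialRandom V p).real B ≤ ∑ G : SimpleGraph V,
      (binomialRandom V p).real {G} * Real.exp s ^ (G.interedges S Sᶜ).card * Real.exp (-b) := by
    rw [h1]
    refine (Finset.sum_le_sum fun G hG => ?_).trans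
      (Finset.sum_le_sum_of_subset_of_nonneg (Finset.subset_univ _) fun G _ _ => by positivity)
    rw [mul_assoc]
    -- On `B` the weight `exp (s * X - b)`, with `X` the cut size, is at least `1`. The sign of `s`
    -- is free: negative for lower tails, positive for upper ones.
    refine le_mul_of_one_le_right measureReal_nonneg ?_
    rw [← Real.exp_nat_mul, ← Real.exp_add]
    refine Real.one_le_exp ?_
    have := hB G (by simpa using hG)
    linarith
  rw [← Finset.sum_mul, sum_binomialRandom_mul_pow_interedges] at h2
  refine h2.trans ?_
  rw [sub_eq_add_neg _ b, Real.exp_add]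
  gcongr
  have hS : ((S.card : ℝ) * (Fintype.card V - S.card))
      = ((S.card * (Fintype.card V - S.card) : ℕ) : ℝ) := by
    rw [Nat.cast_mul, Nat.cast_sub (Finset.card_le_univ S)]
  rw [hS, mul_comm _ ((_ : ℕ) : ℝ), Real.exp_nat_mul]
  have hp0 := p.2.1
  have hp1 := p.2.2
  refine pow_le_pow_left₀ ?_ ?_ _
  · have := Real.exp_pos s
    nlinarith
  · have := Real.add_one_le_exp ((p : ℝ) * (Real.exp s - 1))
    linarith

end RandomGraph

end SimpleGraph

/-! ### Tail bounds and the union bound -/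

namespace SimpleGraph

section Union

variable {n : ℕ} {p : unitInterval} {a c ε : ℝ}

/-- The lower tail of the number of edges leaving a set of at most half of the vertices. -/
theorem binomialRandom_real_card_interedges_lt_le (ha : 0 < a) (ha' : a ≤ 1 / 4) (hc : 0 < c)
    (hε : -Real.log a * ε = a) (hn : 0 < n) (hp : Real.log n ≤ c * (n * p)) (S : Finset (Fin n))
    (hS : 2 * S.card ≤ n) :
    (binomialRandom (Fin n) p).real
        {G | open Classical in ((G.interedges S Sᶜ).card : ℝ) < ε * (n * p) * S.card}
      ≤ Real.exp (-((1 - 3 * a) / c * Real.log n)) ^ S.card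
        + Real.exp (-(a / (8 * c) * n * Real.log n)) := by
  have hla : Real.log a < 0 := Real.log_neg ha (by linarith)
  have hS' : 2 * (S.card : ℝ) ≤ n := by exact_mod_cast hS
  have hk0 : (0 : ℝ) ≤ S.card := Nat.cast_nonneg _
  have hn0 : (0 : ℝ) < n := Nat.cast_pos.2 hn
  have hp0 : 0 ≤ (p : ℝ) := p.2.1
  have hl0 : 0 ≤ Real.log n := Real.log_nonneg (by exact_mod_cast hn)
  have hd : Real.log n / c ≤ n * p := by rwa [div_le_iff₀ hc, mul_comm]
  -- With `s = log a`, the relation `hε` turns the threshold `ε np |S|` into a loss of only `a np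
  -- |S|` in the exponent.
  refine (binomialRandom_real_le_of_interedges (s := Real.log a) (b := -(a * (n * p) * S.card))
    p S ?_).trans ?_
  · intro G hG
    rw [Set.mem_ofPred_eq] at hG
    have h2 := mul_le_mul_of_nonneg_left hG.le (neg_nonneg.2 hla.le)
    have h3 : -Real.log a * (ε * (n * p) * S.card) = a * (n * p) * S.card := by
      linear_combination (n * p * S.card : ℝ) * hε
    rw [h3, neg_mul, neg_le] at h2
    refine h2.trans_eq ?_
    congr!
  rw [Real.exp_log ha, Fintype.card_fin]
  -- Small sets have `n - |S| ≥ (1-a)n`, giving the rate `(1-a)² - a ≥ 1 - 3a`. Large ones only have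
  -- `n - |S| ≥ n/2`, giving `(1-a)/2 - a ≥ 1/8`.
  rcases le_or_gt (S.card : ℝ) (a * n) with hk | hk
  · refine le_add_of_le_of_nonneg ?_ (Real.exp_pos _).le
    rw [← Real.exp_nat_mul, Real.exp_le_exp]
    have h1 : (1 - a) * n ≤ n - S.card := by linarith
    have h2 : (p : ℝ) * S.card * (1 - a) * ((1 - a) * n)
        ≤ p * S.card * (1 - a) * (n - S.card) :=
      mul_le_mul_of_nonneg_left h1 (mul_nonneg (mul_nonneg hp0 hk0) (by linarith))
    have h3 : Real.log n / c * (S.card * (1 - 3 * a)) ≤ n * p * (S.card * (1 - 3 * a)) :=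
      mul_le_mul_of_nonneg_right hd (mul_nonneg hk0 (by linarith))
    have h4 : 0 ≤ (n : ℝ) * p * S.card * a ^ 2 := by positivity
    have h5 : (S.card : ℝ) * -((1 - 3 * a) / c * Real.log n)
        = -(Real.log n / c * (S.card * (1 - 3 * a))) := by ring
    rw [h5]
    nlinarith
  · refine le_add_of_nonneg_of_le (by positivity) ?_
    rw [Real.exp_le_exp]
    have h1 : (n : ℝ) / 2 ≤ n - S.card := by linarith
    have h2 : (p : ℝ) * S.card * (1 - a) * (n / 2)
        ≤ p * S.card * (1 - a) * (n - S.card) :=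
      mul_le_mul_of_nonneg_left h1 (mul_nonneg (mul_nonneg hp0 hk0) (by linarith))
    have h3 : Real.log n / c * (a * n) ≤ n * p * S.card :=
      mul_le_mul hd hk.le (by positivity) (by positivity)
    have h4 : (n : ℝ) * p * S.card * a ≤ n * p * S.card * (1 / 4) :=
      mul_le_mul_of_nonneg_left ha' (by positivity)
    have h5 : -(a / (8 * c) * n * Real.log n) = -(Real.log n / c * (a * n)) / 8 := by ring
    rw [h5]
    nlinarith

/-- The upper tail of the degree of a vertex. -/
theorem binomialRandom_real_lt_degree_le (v : Fin n) :
    (binomialRandom (Fin n) p).real {G | open Classical in 4 * (n * p : ℝ) < G.degree v}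
      ≤ Real.exp (-(2 * (n * p))) := by
  have hp0 : 0 ≤ (p : ℝ) := p.2.1
  -- The degree is the cut size of `{v}`; with `s = 1` the exponent is at most `(e - 1)np - 4np ≤
  -- -2np`.
  refine (binomialRandom_real_le_of_interedges (s := 1) (b := 4 * (n * p)) p {v} ?_).trans ?_
  · intro G hG
    have h1 : 4 * (n * p : ℝ) < _ := hG
    classical
    have h2 : (G.interedges {v} {v}ᶜ).card = G.degree v := by
      rw [← card_neighborFinset_eq_degree]
      refine Finset.card_nbij' Prod.snd (fun w => (v, w)) ?_ ?_ ?_ ?_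
      · rintro ⟨x, y⟩ h
        simp only [Finset.mem_coe, mem_interedges_iff, Finset.mem_singleton] at h
        simpa [← h.1] using h.2.2
      · intro w h
        have h' : G.Adj v w := by simpa using h
        simp [mem_interedges_iff, h', h'.ne']
      · rintro ⟨x, y⟩ h
        simp only [Finset.mem_coe, mem_interedges_iff, Finset.mem_singleton] at h
        simp [h.1]
      · exact fun w _ => rfl
    rw [one_mul]
    refine h1.le.trans_eq ?_
    convert congrArg (Nat.cast (R := ℝ)) h2.symm
  · rw [Real.exp_le_exp, Fintype.card_fin, Finset.card_singleton, Nat.cast_one, one_mul]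
    have he : Real.exp 1 - 1 ≤ 2 := by linarith [Real.exp_one_lt_three]
    have he0 : 0 ≤ Real.exp 1 - 1 := by linarith [Real.add_one_le_exp (1 : ℝ)]
    have h1 : (p : ℝ) * (Real.exp 1 - 1) * (n - 1) ≤ p * (Real.exp 1 - 1) * n :=
      mul_le_mul_of_nonneg_left (by linarith) (mul_nonneg hp0 he0)
    have h2 : (n : ℝ) * p * (Real.exp 1 - 1) ≤ n * p * 2 :=
      mul_le_mul_of_nonneg_left he (by positivity)
    linarith

/-- The three terms account for small cuts, large cuts and degrees. -/
theorem binomialRandom_real_algebraicConnectivity_lt_le (ha : 0 < a) (ha' : a ≤ 1 / 4)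
    (hc : 0 < c) (hc' : c ≤ 1) (hε0 : 0 ≤ ε) (hε : -Real.log a * ε = a) (hn : 2 ≤ n)
    (hp : Real.log n ≤ c * (n * p)) :
    (binomialRandom (Fin n) p).real
        {G | ¬ ε ^ 2 / 8 * (n * p) ≤ algebraicConnectivity G}
      ≤ (Real.exp (Real.exp ((1 - (1 - 3 * a) / c) * Real.log n)) - 1)
        + Real.exp (n * (Real.log 2 - a / (8 * c) * Real.log n)) + Real.exp (-Real.log n) := by
  classical
  have hn0 : (0 : ℝ) < n := by exact_mod_cast (by omega : 0 < n)
  have hl0 : 0 < Real.log n := Real.log_pos (by exact_mod_cast (by omega : 1 < n))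
  have hd : 0 < (n : ℝ) * p := by
    by_contra! h
    nlinarith
  set 𝒮 := (Finset.univ : Finset (Finset (Fin n))).filter fun S => S.Nonempty ∧ 2 * S.card ≤ n
  set B : Finset (Fin n) → Set (SimpleGraph (Fin n)) :=
    fun S => {G | ((G.interedges S Sᶜ).card : ℝ) < ε * (n * p) * S.card}
  set D : Fin n → Set (SimpleGraph (Fin n)) := fun v => {G | 4 * (n * p : ℝ) < G.degree v}
  have hsub : {G : SimpleGraph (Fin n) | ¬ ε ^ 2 / 8 * (n * p) ≤ algebraicConnectivity G}
      ⊆ (⋃ S ∈ 𝒮, B S) ∪ ⋃ v ∈ Finset.univ, D v := by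
    intro G hG
    by_contra hGB
    apply hG
    simp only [Set.mem_union, Set.mem_iUnion, not_or, not_exists] at hGB
    obtain ⟨h1, h2⟩ := hGB
    have := cheeger_le_algebraicConnectivity G (by simpa using hn) (h := ε * (n * p))
      (D := 4 * (n * p)) (by positivity) (by positivity) (by
        intro S hS
        rw [Fintype.card_fin] at hS
        rcases S.eq_empty_or_nonempty with rfl | hSn
        · simp
        · exact not_lt.1 (h1 S (by simp [𝒮, hSn, hS]))) fun v => not_lt.1 (h2 v (by simp))
    refine le_trans (le_of_eq ?_) this
    field_simp
    ring
  set q := Real.exp (-((1 - 3 * a) / c * Real.log n))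
  set r := Real.exp (-(a / (8 * c) * n * Real.log n))
  have hcut : (binomialRandom (Fin n) p).real (⋃ S ∈ 𝒮, B S) ≤ ((1 + q) ^ n - 1) + 2 ^ n * r := by
    have hpow : ∑ S : Finset (Fin n), q ^ S.card = (1 + q) ^ n := by
      rw [add_comm]
      simpa using Finset.sum_pow_mul_eq_add_pow q 1 (Finset.univ : Finset (Fin n))
    calc _ ≤ ∑ S ∈ 𝒮, (binomialRandom (Fin n) p).real (B S) := measureReal_biUnion_finset_le _ _
      _ ≤ ∑ S ∈ 𝒮, (q ^ S.card + r) := Finset.sum_le_sum fun S hS => by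
          convert binomialRandom_real_card_interedges_lt_le ha ha' hc hε (by omega) hp S
            (Finset.mem_filter.1 hS).2.2
      -- Excluding `∅` is essential: it yields the `-1` without which the bound would not vanish.
      _ ≤ ∑ S ∈ (Finset.univ : Finset (Finset (Fin n))).erase ∅, (q ^ S.card + r) := by
          refine Finset.sum_le_sum_of_subset_of_nonneg ?_ fun _ _ _ => by positivity
          intro S hS
          simpa using (Finset.mem_filter.1 hS).2.1.ne_empty
      _ ≤ ((1 + q) ^ n - 1) + 2 ^ n * r := by
          rw [← hpow, ← Finset.add_sum_erase _ _ (Finset.mem_univ (∅ : Finset (Fin n))),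
            Finset.sum_add_distrib]
          simp only [Finset.card_empty, pow_zero, add_sub_cancel_left, Finset.sum_const,
            nsmul_eq_mul]
          gcongr
          refine (Nat.cast_le.2 (Finset.card_erase_le)).trans ?_
          simp
  have hdeg : (binomialRandom (Fin n) p).real (⋃ v ∈ Finset.univ, D v) ≤ Real.exp (-Real.log n) := by
    calc _ ≤ ∑ v, (binomialRandom (Fin n) p).real (D v) := measureReal_biUnion_finset_le _ _
      _ ≤ ∑ v : Fin n, Real.exp (-(2 * (n * p))) := Finset.sum_le_sum fun v _ => by
          convert binomialRandom_real_lt_degree_le v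
      _ = Real.exp (Real.log n + -(2 * (n * p))) := by
          rw [Real.exp_add, Real.exp_log hn0]
          simp
      _ ≤ _ := by
          rw [Real.exp_le_exp]
          nlinarith
  have hq : (1 + q) ^ n ≤ Real.exp (Real.exp ((1 - (1 - 3 * a) / c) * Real.log n)) := by
    have h1 : Real.exp ((1 - (1 - 3 * a) / c) * Real.log n) = n * q := by
      rw [sub_mul, one_mul, sub_eq_add_neg, Real.exp_add, Real.exp_log hn0]
    rw [h1, Real.exp_nat_mul]
    gcongr
    linarith [Real.add_one_le_exp q]
  have hr : 2 ^ n * r = Real.exp (n * (Real.log 2 - a / (8 * c) * Real.log n)) := by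
    rw [mul_sub, sub_eq_add_neg, Real.exp_add, Real.exp_nat_mul, Real.exp_log two_pos]
    congr 1
    refine congrArg Real.exp ?_
    ring
  calc _ ≤ _ := measureReal_mono hsub
    _ ≤ _ := measureReal_union_le _ _
    _ ≤ _ := by linarith

end Union

end SimpleGraph

/-! ### Passage to the limit -/

theorem tendsto_failure_bound {a c : ℝ} (ha : 0 < a) (hc : 0 < c) (hac : c < 1 - 3 * a) :
    Tendsto (fun n : ℕ => (Real.exp (Real.exp ((1 - (1 - 3 * a) / c) * Real.log n)) - 1)
        + Real.exp (n * (Real.log 2 - a / (8 * c) * Real.log n)) + Real.exp (-Real.log n))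
      atTop (𝓝 0) := by
  have hlog : Tendsto (fun n : ℕ => Real.log n) atTop atTop :=
    Real.tendsto_log_atTop.comp tendsto_natCast_atTop_atTop
  have h1 : Tendsto (fun n : ℕ => Real.exp ((1 - (1 - 3 * a) / c) * Real.log n)) atTop (𝓝 0) := by
    refine Real.tendsto_exp_atBot.comp (hlog.const_mul_atTop_of_neg ?_)
    rw [sub_neg, lt_div_iff₀ hc]
    linarith
  have h2 : Tendsto (fun n : ℕ => Real.exp (Real.exp ((1 - (1 - 3 * a) / c) * Real.log n)) - 1)
      atTop (𝓝 0) := by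
    have := ((Real.continuous_exp.tendsto 0).comp h1).sub_const 1
    simpa using this
  have h3 : Tendsto (fun n : ℕ => Real.exp (n * (Real.log 2 - a / (8 * c) * Real.log n)))
      atTop (𝓝 0) := by
    refine Real.tendsto_exp_atBot.comp (tendsto_natCast_atTop_atTop.atTop_mul_atBot₀ ?_)
    have := tendsto_atBot_add_const_left atTop (Real.log 2)
      (hlog.const_mul_atTop_of_neg (r := -(a / (8 * c))) (by rw [neg_lt_zero]; positivity))
    refine this.congr fun n => by ring
  have h4 : Tendsto (fun n : ℕ => Real.exp (-Real.log n)) atTop (𝓝 0) :=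
    Real.tendsto_exp_atBot.comp (tendsto_neg_atTop_atBot.comp hlog)
  simpa using (h2.add h3).add h4

/-- The quotient `ln n / (n p)` is taken in `[0, ∞]`, so that it is `∞` when `n ≥ 2` and `p n = 0`,
and its limit superior needs no boundedness assumption. -/
theorem corollary1 (p : ℕ → unitInterval)
    (hp : limsup (fun n : ℕ => ENNReal.ofReal (Real.log (n : ℝ)) /
      ENNReal.ofReal ((n : ℝ) * (p n : ℝ))) atTop < 1) :
    ∃ γ : ℝ, 0 < γ ∧
      AsymptoticallyAlmostSurely p
        (fun n G => γ * ((n : ℝ) * (p n : ℝ)) ≤ algebraicConnectivity G) := by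
  obtain ⟨c', hc1, hc2⟩ := exists_between hp
  lift c' to NNReal using (hc2.trans ENNReal.one_lt_top).ne
  have hc0 : 0 < (c' : ℝ) := by
    have : (0 : ENNReal) < c' := zero_le.trans_lt hc1
    exact_mod_cast this
  have hclt : (c' : ℝ) < 1 := by exact_mod_cast hc2
  set c : ℝ := (c' : ℝ)
  -- Then `1 - 3a = (1 + 3c)/4 > c`, as the small cuts require, and `a ≤ 1/4`.
  set a : ℝ := (1 - c) / 4 with ha
  have ha0 : 0 < a := by linarith
  have hla : 0 < -Real.log a := neg_pos.2 (Real.log_neg ha0 (by linarith))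
  set ε : ℝ := a / -Real.log a
  have hε : 0 < ε := div_pos ha0 hla
  have hε' : -Real.log a * ε = a := mul_div_cancel₀ _ hla.ne'
  refine ⟨ε ^ 2 / 8, by positivity, ?_⟩
  have hev : ∀ᶠ n : ℕ in atTop, Real.log n ≤ c * (n * p n) := by
    filter_upwards [eventually_lt_of_limsup_lt hc1] with n hn
    rw [← ENNReal.ofReal_le_ofReal_iff (mul_nonneg hc0.le (mul_nonneg n.cast_nonneg (p n).2.1)),
      ENNReal.ofReal_mul hc0.le, ENNReal.ofReal_coe_nnreal]
    exact (ENNReal.div_le_iff_le_mul (Or.inr ENNReal.coe_ne_top)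
      (Or.inl ENNReal.ofReal_ne_top)).1 hn.le
  have hlim : Tendsto (fun n => (SimpleGraph.binomialRandom (Fin n) (p n)).real
      {G | ¬ ε ^ 2 / 8 * (n * p n) ≤ algebraicConnectivity G}) atTop (𝓝 0) := by
    refine tendsto_of_tendsto_of_tendsto_of_le_of_le' tendsto_const_nhds
      (tendsto_failure_bound (a := a) (c := c) ha0 hc0 (by linarith))
      (Eventually.of_forall fun n => measureReal_nonneg) ?_
    filter_upwards [hev, eventually_ge_atTop 2] with n hn hn2
    exact SimpleGraph.binomialRandom_real_algebraicConnectivity_lt_le ha0 (by linarith) hc0 hclt.le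
      hε.le hε' hn2 hn
  have hlim' := ENNReal.tendsto_ofReal (hlim.const_sub 1)
  rw [sub_zero, ENNReal.ofReal_one] at hlim'
  refine hlim'.congr fun n => ?_
  have hm := probReal_compl_eq_one_sub (μ := SimpleGraph.binomialRandom (Fin n) (p n))
    (s := {G | ¬ ε ^ 2 / 8 * (n * p n) ≤ algebraicConnectivity G}) (Set.toFinite _).measurableSet
  rw [← hm, ofReal_measureReal]
  congr 1
  ext G
  simp
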